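/- Let $m>n>k\ge 1$ be integers and let $U$ be an $m\times m$ unitary matrix (a linear optical interferometer on $m$ modes). Bit strings of length $m$ with exactly $n$ ones represent collision-free configurations of $n$ photons. Fix such an input configuration $T$; for an output bit string $s$ with $n$ ones let $U_{T,s}$ be the $n\times n$ submatrix of $U$ with rows indexed by the ones of $T$ and columns by the ones of $s$, and put $$p(s)=|\mathrm{Per}(U_{T,s})|^2,\qquad p_{\max}=\max_s p(s),\qquad p_{\rm unif}=\binom mn^{-1}.$$ For an $n$-photon bit string $s$ let $\mathcal L(s)$ be the set of bit strings obtained from $s$ by replacing exactly $k$ ones by zeros, and for a bit string $r$ with $n-k$ ones let $\mathcal G(r)$ be the set of bit strings obtained from $r$ by replacing exactly $k$ zeros by ones. The interference term is $$I_{s,k}=\frac{1}{\left(\binom{m-n+k}{k}-1\right)\binom nk}\sum_{r\in\mathcal L(s)}\ \sum_{s'\in\mathcal G(r),\,s'\ne s}p(s'),$$ and the bias error is $|I_{s,k}-p_{\rm unif}|$. For an $n\times n$ complex matrix $A=(a_{ij})$ let $\|A\|_2$ be its operator 2-norm and $h_\infty^A=\frac1n\sum_{i=1}^n\max_j|a_{ij}|$.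 Theorem. There is an absolute constant $\delta>0$ such that for every $c>0$ there is a constant $C>0$, depending only on $c$, with the following property. Let $m,n,k$ be integers with $1\le k<n<m$ and $m\ge c\,n^2$, let $U$ be an $m\times m$ unitary matrix, $T$ a collision-free input configuration of $n$ photons, and $A$ an $n\times n$ submatrix of $U$ with $p_{\max}=|\mathrm{Per}(A)|^2$ (for example $A=U_{T,s}$ with $s$ a most likely output). If $h_\infty^A\le\delta\,\|A\|_2$, then for every $n$-photon output bit string $s$, $$|I_{s,k}-p_{\rm unif}|\le C\,e^{-0.000002\,n}.$$ -/

import Mathlib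

noncomputable section

namespace LinearOptics

/-- Collision-free configurations of `n` photons in `m` modes, i.e. bit strings of length `m` with
exactly `n` ones; a bit string is represented by its set of occupied modes. -/
abbrev Config (m n : ℕ) : Type := {S : Finset (Fin m) // S.card = n}

/-- The `n × n` submatrix `U_{T,S}` of `U`: rows given by the input configuration `T`, columns by
the output configuration `S`, both in increasing order. -/
def scatteringMatrix {m n : ℕ} (U : Matrix (Fin m) (Fin m) ℂ) (T S : Config m n) :
    Matrix (Fin n) (Fin n) ℂ :=
  U.submatrix (T.1.orderEmbOfFin T.2) (S.1.orderEmbOfFin S.2)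

/-- The ideal (lossless) probability `p(S) = |Per(U_{T,S})|²` of the output `S`, for the
collision-free input `T` and the collision-free output `S`. -/
def outputProb {m n : ℕ} (U : Matrix (Fin m) (Fin m) ℂ) (T S : Config m n) : ℝ :=
  ‖(scatteringMatrix U T S).permanent‖ ^ 2

/-- The largest ideal probability `p_max = max_S p(S)` of an `n`-photon output bit string. -/
def maxProb {m n : ℕ} (U : Matrix (Fin m) (Fin m) ℂ) (T : Config m n) : ℝ :=
  ⨆ S : Config m n, outputProb U T S

/-- `L(s)`: the `(n-k)`-photon bit strings obtained from `s` by replacing `k` ones by zeros. -/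
def lossyOutputs {m n : ℕ} (k : ℕ) (s : Config m n) : Finset (Config m (n - k)) :=
  Finset.univ.filter fun r => r.1 ⊆ s.1

/-- `G(r)`: the `n`-photon bit strings obtained from the `(n-k)`-photon bit string `r` by
replacing `k` zeros by ones. -/
def generatedOutputs {m n k : ℕ} (r : Config m (n - k)) : Finset (Config m n) :=
  Finset.univ.filter fun s => r.1 ⊆ s.1

/-- The interference term
`I_{s,k} = ∑_{r ∈ L(s)} ∑_{s' ∈ G(r), s' ≠ s} p(s') / N'_k`, where
`N'_k = (binom(m-n+k, k) - 1) * binom(n, k)`. -/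
def interference {m n : ℕ} (U : Matrix (Fin m) (Fin m) ℂ) (T : Config m n) (k : ℕ)
    (s : Config m n) : ℝ :=
  (∑ r ∈ lossyOutputs k s, ∑ s' ∈ (generatedOutputs r).erase s, outputProb U T s') /
    ((((m - n + k).choose k : ℝ) - 1) * (n.choose k : ℝ))

/-- The uniform probability `p_unif = 1 / binom(m, n)`. -/
def unifProb (m n : ℕ) : ℝ := 1 / (m.choose n : ℝ)

/-- The bias error `|I_{s,k} - p_unif|`. -/
def biasError {m n : ℕ} (U : Matrix (Fin m) (Fin m) ℂ) (T : Config m n) (k : ℕ)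
    (s : Config m n) : ℝ :=
  |interference U T k s - unifProb m n|

/-- The operator 2-norm of a square complex matrix acting on Euclidean space. -/
def opNorm {n : ℕ} (A : Matrix (Fin n) (Fin n) ℂ) : ℝ :=
  ‖Matrix.toEuclideanCLM (n := Fin n) (𝕜 := ℂ) A‖

/-- `h_∞^A = (1/n) ∑_i max_j |a_{ij}|`, the average of the sup norms of the rows of `A`. -/
def rowSupAverage {n : ℕ} (A : Matrix (Fin n) (Fin n) ℂ) : ℝ :=
  (1 / (n : ℝ)) * ∑ i : Fin n, ⨆ j : Fin n, ‖A i j‖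

end LinearOptics

end

/-! ### Entropy and concentration on the discrete cube. -/

namespace SignCube

open Finset

/-! The interference term is an average of output probabilities, so the bias error is at most the
larger of `maxProb` and `unifProb`. The uniform probability is handled by binomial estimates; the
substance is that `|Per A| ≤ exp (-0.000001 n)` for a contraction `A` whose rows have small sup
norms on average.

Glynn's formula writes `Per A` as a mean over sign vectors `x`, whence `|Per A| ≤ E ∏ |y_i|` with `y
= A x`. Since `∑ |y_i|² ≤ n`, the arithmetic-geometric mean inequality bounds the product by 1, with
a loss only if all `|y_i|²` are near 1. `le_exp_sub_one_sub` sharpens it: `prod_norm_le` bounds the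
product by an exponential that decreases in `gaussianSum A x = ∑ exp (-|y_i|²/5)`.

Two facts then give exponential decay. A signed sum of many small terms has a spread-out modulus, so
comparing moments shows that the mean of `gaussianSum` strictly exceeds its value at `|y_i| = 1`
(`le_mean_gaussianSum`). And `gaussianSum` has discrete gradient of squared length `O(n)`, so the
modified logarithmic Sobolev inequality and Herbst's argument (`mean_exp_le`) control its
exponential moments. In `norm_permanent_le` the gain in the mean beats the variance term. -/

/-- The discrete cube of sign vectors of length `n`. -/
abbrev Cube (n : ℕ) : Type := Fin n → ℤˣ

/-- The mean of a real function over the uniformly distributed sign vectors of length `n`. -/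
noncomputable def mean {n : ℕ} (f : Cube n → ℝ) : ℝ := (∑ x, f x) / 2 ^ n

/-- The sign vector `x` with the sign of its coordinate `j` reversed. -/
def flip {n : ℕ} (x : Cube n) (j : Fin n) : Cube n := Function.update x j (-x j)

theorem mean_zero (f : Cube 0 → ℝ) : mean f = f default := by
  simp only [mean, pow_zero, div_one]
  exact (Fintype.sum_unique f).trans (congrArg f (Subsingleton.elim _ _))

theorem sum_succ {M : Type*} [AddCommMonoid M] {n : ℕ} (f : Cube (n + 1) → M) :
    ∑ x, f x = ∑ x : Cube n, f (Fin.cons 1 x) + ∑ x : Cube n, f (Fin.cons (-1) x) := by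
  rw [← (Fin.consEquiv fun _ : Fin (n + 1) => ℤˣ).sum_comp, Fintype.sum_prod_type]
  have h : (univ : Finset ℤˣ) = {1, -1} := rfl
  rw [h, sum_pair (by decide)]
  rfl

theorem mean_succ {n : ℕ} (f : Cube (n + 1) → ℝ) :
    mean f = (mean (fun x : Cube n => f (Fin.cons 1 x)) +
      mean (fun x : Cube n => f (Fin.cons (-1) x))) / 2 := by
  simp only [mean, sum_succ, pow_succ]
  field_simp

theorem mean_add {n : ℕ} (f g : Cube n → ℝ) : mean (fun x => f x + g x) = mean f + mean g := by
  simp [mean, sum_add_distrib, add_div]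

theorem mean_sub {n : ℕ} (f g : Cube n → ℝ) : mean (fun x => f x - g x) = mean f - mean g := by
  simp [mean, sum_sub_distrib, sub_div]

theorem mean_const_mul {n : ℕ} (c : ℝ) (f : Cube n → ℝ) :
    mean (fun x => c * f x) = c * mean f := by
  simp [mean, ← mul_sum, mul_div_assoc]

theorem mean_const {n : ℕ} (c : ℝ) : mean (fun _ : Cube n => c) = c := by
  simp [mean]

theorem mean_sum {n : ℕ} {ι : Type*} (s : Finset ι) (f : ι → Cube n → ℝ) :
    mean (fun x => ∑ i ∈ s, f i x) = ∑ i ∈ s, mean (f i) := by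
  simp only [mean]
  rw [sum_comm, sum_div]

theorem mean_mono {n : ℕ} {f g : Cube n → ℝ} (h : ∀ x, f x ≤ g x) : mean f ≤ mean g := by
  unfold mean
  gcongr
  exact h _

theorem mean_pos {n : ℕ} {f : Cube n → ℝ} (h : ∀ x, 0 < f x) : 0 < mean f := by
  unfold mean
  have : 0 < ∑ x, f x := sum_pos (fun x _ => h x) univ_nonempty
  positivity

theorem flip_flip {n : ℕ} (x : Cube n) (j : Fin n) : flip (flip x j) j = x := by
  simp [flip]

theorem sum_flip {M : Type*} [AddCommMonoid M] {n : ℕ} (j : Fin n) (f : Cube n → M) :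
    ∑ x, f (flip x j) = ∑ x, f x :=
  Equiv.sum_comp
    (⟨fun x => flip x j, fun x => flip x j, fun x => flip_flip x j, fun x => flip_flip x j⟩ :
      Cube n ≃ Cube n) f

theorem mean_flip {n : ℕ} (j : Fin n) (f : Cube n → ℝ) :
    mean (fun x => f (flip x j)) = mean f := by
  simp only [mean]
  rw [sum_flip]

theorem flip_cons_zero {n : ℕ} (s : ℤˣ) (x : Cube n) :
    flip (Fin.cons s x : Cube (n + 1)) 0 = Fin.cons (-s) x := by
  simp [flip, Fin.update_cons_zero]

theorem flip_cons_succ {n : ℕ} (s : ℤˣ) (x : Cube n) (j : Fin n) :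
    flip (Fin.cons s x : Cube (n + 1)) j.succ = Fin.cons s (flip x j) := by
  simp [flip, Fin.cons_update]

/-- The log-sum inequality. -/
theorem log_sum_le_mean {n : ℕ} {f g : Cube n → ℝ} (hf : ∀ x, 0 < f x) (hg : ∀ x, 0 < g x) :
    mean f * (Real.log (mean f) - Real.log (mean g)) ≤
      mean (fun x => f x * (Real.log (f x) - Real.log (g x))) := by
  have hF := mean_pos hf
  have hG := mean_pos hg
  set F := mean f with hFd
  set G := mean g with hGd
  have key : ∀ x, (Real.log F - Real.log G + 1) * f x - F / G * g x ≤
      f x * (Real.log (f x) - Real.log (g x)) := by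
    intro x
    have h1 := hf x
    have h2 := hg x
    have h3 := Real.log_le_sub_one_of_pos (show 0 < g x * F / (f x * G) by positivity)
    rw [Real.log_div (by positivity) (by positivity), Real.log_mul h2.ne' hF.ne',
      Real.log_mul h1.ne' hG.ne'] at h3
    have h4 := mul_le_mul_of_nonneg_left h3 h1.le
    have h5 : f x * (g x * F / (f x * G) - 1) = F / G * g x - f x := by
      field_simp
    rw [h5] at h4
    linarith
  have h := mean_mono key
  rw [mean_sub, mean_const_mul, mean_const_mul, ← hFd, ← hGd] at h
  have h6 : F / G * G = F := by field_simp
  rw [h6] at h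
  linarith

/-- The log-sum inequality added to itself with `f` and `g` exchanged. It is Jensen's inequality for
`(a - b)(log a - log b)`, and it makes the entropy inequality tensorize. -/
theorem sub_mul_log_sub_le_mean {n : ℕ} {f g : Cube n → ℝ} (hf : ∀ x, 0 < f x)
    (hg : ∀ x, 0 < g x) :
    (mean f - mean g) * (Real.log (mean f) - Real.log (mean g)) ≤
      mean (fun x => (f x - g x) * (Real.log (f x) - Real.log (g x))) := by
  have h1 := log_sum_le_mean hf hg
  have h2 := log_sum_le_mean hg hf
  have h3 : mean (fun x => (f x - g x) * (Real.log (f x) - Real.log (g x))) =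
      mean (fun x => f x * (Real.log (f x) - Real.log (g x))) +
        mean (fun x => g x * (Real.log (g x) - Real.log (f x))) := by
    rw [← mean_add]
    congr 1
    funext x
    ring
  rw [h3]
  linarith

theorem two_point_entropy_le {a b : ℝ} (ha : 0 < a) (hb : 0 < b) :
    (a * Real.log a + b * Real.log b) / 2 - (a + b) / 2 * Real.log ((a + b) / 2) ≤
      (a - b) * (Real.log a - Real.log b) / 4 := by
  have h := strictConcaveOn_log_Ioi.concaveOn.2 (Set.mem_Ioi.2 ha) (Set.mem_Ioi.2 hb)
    (by norm_num : (0 : ℝ) ≤ 1 / 2) (by norm_num : (0 : ℝ) ≤ 1 / 2) (by norm_num)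
  simp only [smul_eq_mul] at h
  rw [show 1 / 2 * a + 1 / 2 * b = (a + b) / 2 by ring] at h
  have := mul_le_mul_of_nonneg_left h (show 0 ≤ (a + b) / 2 by positivity)
  nlinarith

/-- The modified logarithmic Sobolev inequality on the discrete cube. -/
theorem entropy_le {n : ℕ} (f : Cube n → ℝ) (hf : ∀ x, 0 < f x) :
    mean (fun x => f x * Real.log (f x)) - mean f * Real.log (mean f) ≤
      (∑ j, mean (fun x => (f x - f (flip x j)) *
        (Real.log (f x) - Real.log (f (flip x j))))) / 4 := by
  induction n with
  | zero => simp [mean_zero]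
  | succ n ih =>
    have h1 := ih (fun x => f (Fin.cons 1 x)) fun x => hf _
    have h2 := ih (fun x => f (Fin.cons (-1) x)) fun x => hf _
    -- The entropy splits into the mean entropy of the two half-cubes, handled by induction, and the
    -- entropy of the pair of half-cube means; `h3` and `h4` bound the latter by the flips of the
    -- new coordinate.
    have h3 := two_point_entropy_le (mean_pos fun x : Cube n => hf (Fin.cons 1 x))
      (mean_pos fun x : Cube n => hf (Fin.cons (-1) x))
    have h4 := sub_mul_log_sub_le_mean (fun x : Cube n => hf (Fin.cons 1 x))
      (fun x : Cube n => hf (Fin.cons (-1) x))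
    rw [Fin.sum_univ_succ]
    simp only [mean_succ, flip_cons_zero, flip_cons_succ, neg_neg, ← sum_div, sum_add_distrib]
    have h5 : mean (fun x : Cube n => (f (Fin.cons (-1) x) - f (Fin.cons 1 x)) *
        (Real.log (f (Fin.cons (-1) x)) - Real.log (f (Fin.cons 1 x)))) =
        mean (fun x : Cube n => (f (Fin.cons 1 x) - f (Fin.cons (-1) x)) *
        (Real.log (f (Fin.cons 1 x)) - Real.log (f (Fin.cons (-1) x)))) := by
      congr 1
      funext x
      ring
    rw [h5]
    linarith

theorem exp_sub_mul_sub_le (a b : ℝ) :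
    (Real.exp a - Real.exp b) * (a - b) ≤ (a - b) ^ 2 * (Real.exp a + Real.exp b) := by
  have key : ∀ a b : ℝ, Real.exp a - Real.exp b ≤ (a - b) * Real.exp a := by
    intro a b
    have h := Real.add_one_le_exp (b - a)
    have h2 : Real.exp b = Real.exp a * Real.exp (b - a) := by
      rw [← Real.exp_add]
      ring_nf
    rw [h2]
    nlinarith [Real.exp_pos a]
  rcases le_total b a with h | h
  · have := mul_le_mul_of_nonneg_right (key a b) (sub_nonneg.2 h)
    nlinarith [mul_nonneg (sq_nonneg (a - b)) (Real.exp_pos b).le]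
  · have := mul_le_mul_of_nonneg_right (key b a) (sub_nonneg.2 h)
    nlinarith [mul_nonneg (sq_nonneg (a - b)) (Real.exp_pos a).le]

theorem entropy_exp_le {n : ℕ} (g : Cube n → ℝ) {W : ℝ}
    (hW : ∀ x, ∑ j, (g (flip x j) - g x) ^ 2 ≤ W) :
    mean (fun x => Real.exp (g x) * g x) -
      mean (fun x => Real.exp (g x)) * Real.log (mean fun x => Real.exp (g x)) ≤
      W / 2 * mean (fun x => Real.exp (g x)) := by
  have h := entropy_le (fun x => Real.exp (g x)) fun x => Real.exp_pos _
  simp only [Real.log_exp] at h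
  refine h.trans ?_
  have h1 : ∀ j, mean (fun x => (Real.exp (g x) - Real.exp (g (flip x j))) *
      (g x - g (flip x j))) ≤
      2 * mean (fun x => (g (flip x j) - g x) ^ 2 * Real.exp (g x)) := by
    intro j
    have h2 : mean (fun x => (g (flip x j) - g x) ^ 2 * Real.exp (g (flip x j))) =
        mean (fun x => (g (flip x j) - g x) ^ 2 * Real.exp (g x)) := by
      rw [← mean_flip j]
      simp only [flip_flip]
      congr 1
      funext x
      ring
    calc _ ≤ mean (fun x => (g (flip x j) - g x) ^ 2 * Real.exp (g x) +
          (g (flip x j) - g x) ^ 2 * Real.exp (g (flip x j))) := by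
          refine mean_mono fun x => (exp_sub_mul_sub_le _ _).trans (le_of_eq ?_)
          ring
      _ = _ := by rw [mean_add, h2]; ring
  have h3 : ∑ j, mean (fun x => (g (flip x j) - g x) ^ 2 * Real.exp (g x)) ≤
      W * mean (fun x => Real.exp (g x)) := by
    rw [← mean_sum, ← mean_const_mul]
    refine mean_mono fun x => ?_
    rw [← sum_mul]
    exact mul_le_mul_of_nonneg_right (hW x) (Real.exp_pos _).le
  have h4 := sum_le_sum fun j (_ : j ∈ univ) => h1 j
  rw [← mul_sum] at h4
  linarith

/-- The hypothesis says that `H t / t - K t` has nonpositive derivative; its limit at `0` is `H' 0`.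
It is applied to the logarithm of a Laplace transform. -/
theorem herbst {H H' : ℝ → ℝ} {K : ℝ} (hH : ∀ t, HasDerivAt H (H' t) t) (h0 : H 0 = 0)
    (h : ∀ t, 0 < t → t * H' t - H t ≤ K * t ^ 2) {t : ℝ} (ht : 0 < t) :
    H t ≤ t * H' 0 + K * t ^ 2 := by
  have hder : ∀ s ∈ Set.Ioi (0 : ℝ), HasDerivAt (fun s => H s / s - K * s)
      ((H' s * s - H s * 1) / s ^ 2 - K * 1) s := fun s hs =>
    ((hH s).div (hasDerivAt_id s) (ne_of_gt hs)).sub ((hasDerivAt_id s).const_mul K)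
  have hanti : AntitoneOn (fun s => H s / s - K * s) (Set.Ioi 0) := by
    refine antitoneOn_of_deriv_nonpos (convex_Ioi 0)
      (fun s hs => (hder s hs).continuousAt.continuousWithinAt)
      (fun s hs => (hder s (interior_subset hs)).differentiableAt.differentiableWithinAt) ?_
    intro s hs
    have hs' : 0 < s := interior_subset hs
    rw [(hder s hs').deriv, sub_nonpos, div_le_iff₀ (by positivity)]
    have := h s hs'
    linarith
  have hlim : Filter.Tendsto (fun s => H s / s - K * s) (nhdsWithin 0 (Set.Ioi 0))
      (nhds (H' 0 - K * 0)) := by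
    refine Filter.Tendsto.sub ?_ ?_
    · have h1 := (hasDerivAt_iff_tendsto_slope.1 (hH 0)).mono_left
        (nhdsWithin_mono 0 fun x (hx : 0 < x) => hx.ne')
      refine h1.congr fun s => ?_
      simp [slope_def_field, h0]
    · exact ((continuous_const.mul continuous_id).tendsto 0).mono_left nhdsWithin_le_nhds
  have hle : H t / t - K * t ≤ H' 0 - K * 0 := by
    refine ge_of_tendsto hlim ?_
    filter_upwards [Ioc_mem_nhdsGT ht] with s hs
    exact hanti hs.1 ht hs.2
  have h2 : H t / t ≤ H' 0 + K * t := by linarith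
  rw [div_le_iff₀ ht] at h2
  linarith

/-- Sub-Gaussian bound for the exponential moments of a function on the discrete cube with bounded
discrete gradient. -/
theorem mean_exp_le {n : ℕ} (F : Cube n → ℝ) {V : ℝ}
    (hV : ∀ x, ∑ j, (F (flip x j) - F x) ^ 2 ≤ V) {t : ℝ} (ht : 0 < t) :
    mean (fun x => Real.exp (-t * F x)) ≤ Real.exp (-t * mean F + V / 2 * t ^ 2) := by
  set Z : ℝ → ℝ := fun t => mean fun x => Real.exp (-t * F x) with hZ
  have hZpos : ∀ t, 0 < Z t := fun t => mean_pos fun x => Real.exp_pos _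
  have hZd : ∀ t, HasDerivAt Z (mean fun x => Real.exp (-t * F x) * (-1 * F x)) t := by
    intro t
    simp only [hZ, mean]
    refine HasDerivAt.div_const (HasDerivAt.fun_sum fun x _ => ?_) _
    exact (((hasDerivAt_id t).neg).mul_const (F x)).exp
  have hHd : ∀ t, HasDerivAt (fun t => Real.log (Z t))
      ((mean fun x => Real.exp (-t * F x) * (-1 * F x)) / Z t) t :=
    fun t => (hZd t).log (hZpos t).ne'
  have h := herbst (K := V / 2) hHd (by simp [hZ, mean_const]) (fun s hs => ?_) ht
  · change Z t ≤ _
    rw [← Real.exp_log (hZpos t)]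
    refine Real.exp_le_exp.2 (h.trans (le_of_eq ?_))
    have h1 : mean (fun x => -1 * F x) = -mean F := by rw [mean_const_mul]; ring
    simp [hZ, mean_const]
    have h2 : mean (fun x => -F x) = -mean F := by rw [← h1]; simp
    rw [h2]
    ring
  · have hent := entropy_exp_le (fun x => -s * F x) (W := s ^ 2 * V) fun x => by
      have : ∀ j, (-s * F (flip x j) - -s * F x) ^ 2 = s ^ 2 * (F (flip x j) - F x) ^ 2 :=
        fun j => by ring
      simp only [this, ← mul_sum]
      exact mul_le_mul_of_nonneg_left (hV x) (sq_nonneg s)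
    have h1 : mean (fun x => Real.exp (-s * F x) * (-s * F x)) =
        s * mean (fun x => Real.exp (-s * F x) * (-1 * F x)) := by
      rw [← mean_const_mul]
      congr 1
      funext x
      ring
    rw [h1] at hent
    have hz := hZpos s
    change s * _ - Z s * Real.log (Z s) ≤ _ * Z s at hent
    rw [mul_div_assoc', sub_le_iff_le_add, div_le_iff₀ hz]
    linarith

end SignCube

/-! ### Moments of signed sums and scalar inequalities. -/

namespace SignCube

open Finset

/-- The signed sum of the entries of a real vector. -/
noncomputable def signSum {n : ℕ} (p : Fin n → ℝ) (x : Cube n) : ℝ := ∑ j, p j * ((x j : ℤ) : ℝ)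

theorem signSum_cons {n : ℕ} (p : Fin (n + 1) → ℝ) (s : ℤˣ) (x : Cube n) :
    signSum p (Fin.cons s x : Cube (n + 1)) =
      p 0 * ((s : ℤ) : ℝ) + signSum (fun j => p j.succ) x := by
  simp [signSum, Fin.sum_univ_succ]

theorem mean_succ' {n : ℕ} (f : Cube (n + 1) → ℝ) :
    mean f = mean (fun x : Cube n => (f (Fin.cons 1 x) + f (Fin.cons (-1) x)) / 2) := by
  rw [mean_succ, ← mean_add]
  simp only [mean, ← sum_div]
  ring

theorem mean_signSum_mul {n : ℕ} (p q : Fin n → ℝ) :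
    mean (fun x => signSum p x * signSum q x) = ∑ j, p j * q j := by
  induction n with
  | zero => simp [mean_zero, signSum]
  | succ n ih =>
    rw [mean_succ', Fin.sum_univ_succ, ← ih]
    have h : ∀ x : Cube n, (signSum p (Fin.cons 1 x : Cube (n + 1)) *
        signSum q (Fin.cons 1 x : Cube (n + 1)) + signSum p (Fin.cons (-1) x : Cube (n + 1)) *
        signSum q (Fin.cons (-1) x : Cube (n + 1))) / 2 = p 0 * q 0 +
        signSum (fun j => p j.succ) x * signSum (fun j => q j.succ) x := by
      intro x
      simp only [signSum_cons]
      push_cast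
      ring
    simp only [h]
    rw [mean_add, mean_const]

theorem mean_sq_add_sq {n : ℕ} (p q : Fin n → ℝ) :
    mean (fun x => signSum p x ^ 2 + signSum q x ^ 2) = ∑ j, (p j ^ 2 + q j ^ 2) := by
  rw [mean_add, sum_add_distrib]
  simp only [sq, mean_signSum_mul]

/-- With `a = p + iq`, the two middle terms are `|∑ a_j²|²`. They are nonnegative and at most `(∑
|a_j|²)²`, which yields both bounds on the fourth moment used below. -/
theorem mean_sq_add_sq_sq {n : ℕ} (p q : Fin n → ℝ) :
    mean (fun x => (signSum p x ^ 2 + signSum q x ^ 2) ^ 2) =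
      2 * (∑ j, (p j ^ 2 + q j ^ 2)) ^ 2 + (∑ j, p j * p j - ∑ j, q j * q j) ^ 2 +
        4 * (∑ j, p j * q j) ^ 2 - 2 * ∑ j, (p j ^ 2 + q j ^ 2) ^ 2 := by
  induction n with
  | zero => simp [mean_zero, signSum]
  | succ n ih =>
    have h : ∀ x : Cube n, ((signSum p (Fin.cons 1 x : Cube (n + 1)) ^ 2 +
        signSum q (Fin.cons 1 x : Cube (n + 1)) ^ 2) ^ 2 +
        (signSum p (Fin.cons (-1) x : Cube (n + 1)) ^ 2 +
        signSum q (Fin.cons (-1) x : Cube (n + 1)) ^ 2) ^ 2) / 2 =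
        (signSum (fun j => p j.succ) x ^ 2 + signSum (fun j => q j.succ) x ^ 2) ^ 2 +
        ((6 * p 0 ^ 2 + 2 * q 0 ^ 2) *
          (signSum (fun j => p j.succ) x * signSum (fun j => p j.succ) x) +
        ((6 * q 0 ^ 2 + 2 * p 0 ^ 2) *
          (signSum (fun j => q j.succ) x * signSum (fun j => q j.succ) x) +
        (8 * p 0 * q 0 * (signSum (fun j => p j.succ) x * signSum (fun j => q j.succ) x) +
        (p 0 ^ 2 + q 0 ^ 2) ^ 2))) := by
      intro x
      simp only [signSum_cons]
      push_cast
      ring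
    rw [mean_succ']
    simp only [h]
    rw [mean_add, mean_add, mean_add, mean_add, mean_const_mul, mean_const_mul, mean_const_mul,
      mean_const, mean_signSum_mul, mean_signSum_mul, mean_signSum_mul, ih]
    simp only [Fin.sum_univ_succ, sum_add_distrib, ← sq]
    ring

theorem mean_sq_add_sq_sq_le {n : ℕ} (p q : Fin n → ℝ) :
    mean (fun x => (signSum p x ^ 2 + signSum q x ^ 2) ^ 2) ≤
      3 * (∑ j, (p j ^ 2 + q j ^ 2)) ^ 2 := by
  rw [mean_sq_add_sq_sq]
  have h1 : (∑ j, p j * q j) ^ 2 ≤ (∑ j, p j ^ 2) * ∑ j, q j ^ 2 := sum_mul_sq_le_sq_mul_sq _ _ _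
  have h2 : 0 ≤ ∑ j, (p j ^ 2 + q j ^ 2) ^ 2 := by positivity
  simp only [sum_add_distrib, ← sq] at h2 ⊢
  nlinarith

theorem mean_sq_add_sq_cube_le {n : ℕ} (p q : Fin n → ℝ) :
    mean (fun x => (signSum p x ^ 2 + signSum q x ^ 2) ^ 3) ≤
      15 * (∑ j, (p j ^ 2 + q j ^ 2)) ^ 3 := by
  induction n with
  | zero => simp [mean_zero, signSum]
  | succ n ih =>
    set P : Fin n → ℝ := fun j => p j.succ with hP
    set Q : Fin n → ℝ := fun j => q j.succ with hQ
    set a := p 0 ^ 2 + q 0 ^ 2 with ha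
    have ha0 : 0 ≤ a := by positivity
    have h : ∀ x : Cube n, ((signSum p (Fin.cons 1 x : Cube (n + 1)) ^ 2 +
        signSum q (Fin.cons 1 x : Cube (n + 1)) ^ 2) ^ 3 +
        (signSum p (Fin.cons (-1) x : Cube (n + 1)) ^ 2 +
        signSum q (Fin.cons (-1) x : Cube (n + 1)) ^ 2) ^ 3) / 2 ≤
        (signSum P x ^ 2 + signSum Q x ^ 2) ^ 3 +
        (15 * a * (signSum P x ^ 2 + signSum Q x ^ 2) ^ 2 +
        (15 * a ^ 2 * (signSum P x ^ 2 + signSum Q x ^ 2) + a ^ 3)) := by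
      intro x
      simp only [signSum_cons]
      push_cast
      set u := signSum P x
      set v := signSum Q x
      -- By Lagrange's identity `(p₀u + q₀v)² = a(u² + v²) - (p₀v - q₀u)²`, this is exactly the
      -- slack in the inequality. The constant 15 is the sixth moment of a real Gaussian.
      have h1 : 0 ≤ 12 * (u ^ 2 + v ^ 2 + a) * (p 0 * v - q 0 * u) ^ 2 := by positivity
      rw [ha] at h1 ⊢
      linarith
    rw [mean_succ', Fin.sum_univ_succ]
    refine (mean_mono h).trans ?_
    rw [mean_add, mean_add, mean_add, mean_const_mul, mean_const_mul, mean_const, mean_sq_add_sq]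
    have h1 := ih P Q
    have h2 := mean_sq_add_sq_sq_le P Q
    have hr : 0 ≤ ∑ j, (P j ^ 2 + Q j ^ 2) := by positivity
    have h3 := mul_le_mul_of_nonneg_left h2 (by positivity : 0 ≤ 15 * a)
    change _ ≤ 15 * (a + ∑ j, (P j ^ 2 + Q j ^ 2)) ^ 3
    set r := ∑ j, (P j ^ 2 + Q j ^ 2)
    have h4 : 0 ≤ 30 * a ^ 2 * r + 14 * a ^ 3 := by positivity
    linarith

theorem cubic_le_exp (x : ℝ) : 1 + x + x ^ 2 / 2 + x ^ 3 / 6 ≤ Real.exp x := by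
  rcases le_total 0 x with hx | hx
  · have h := Real.sum_le_exp_of_nonneg hx 4
    simp [sum_range_succ, Nat.factorial] at h
    linarith
  · have hd : ∀ y : ℝ, HasDerivAt (fun y => Real.exp y * (1 - y + y ^ 2 / 2 - y ^ 3 / 6))
        (Real.exp y * (1 - y + y ^ 2 / 2 - y ^ 3 / 6) + Real.exp y * (-1 + y - y ^ 2 / 2)) y := by
      intro y
      refine (Real.hasDerivAt_exp y).mul ?_
      have h1 := (((hasDerivAt_const y (1 : ℝ)).sub (hasDerivAt_id y)).add
        ((hasDerivAt_pow 2 y).div_const 2)).sub ((hasDerivAt_pow 3 y).div_const 6)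
      refine h1.congr_deriv ?_
      norm_num
      ring
    have hanti : AntitoneOn (fun y => Real.exp y * (1 - y + y ^ 2 / 2 - y ^ 3 / 6))
        (Set.Ici 0) := by
      refine antitoneOn_of_deriv_nonpos (convex_Ici 0)
        (fun y _ => (hd y).continuousAt.continuousWithinAt)
        (fun y _ => (hd y).differentiableAt.differentiableWithinAt) fun y hy => ?_
      have hy' : 0 ≤ y := (interior_subset hy : y ∈ Set.Ici (0 : ℝ))
      rw [(hd y).deriv]
      have : 0 ≤ Real.exp y * y ^ 3 := by positivity
      linarith
    have h := hanti (Set.mem_Ici.2 le_rfl) (Set.mem_Ici.2 (neg_nonneg.2 hx)) (neg_nonneg.2 hx)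
    simp only [Real.exp_zero] at h
    have h2 := mul_le_mul_of_nonneg_left h (Real.exp_pos x).le
    rw [← mul_assoc, ← Real.exp_add] at h2
    simp only [add_neg_cancel, Real.exp_zero] at h2
    linarith

/-- Lower bound for the mean of a Gaussian function of a complex signed sum with small terms: it is
bounded away from the value of the function on the unit circle. -/
theorem le_mean_exp {n : ℕ} (p q : Fin n → ℝ) {σ : ℝ} (hσ : ∀ j, p j ^ 2 + q j ^ 2 ≤ σ)
    (hσ0 : 0 ≤ σ) (hr : ∑ j, (p j ^ 2 + q j ^ 2) ≤ 1) :
    1.005 - 0.048 * σ ≤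
      mean (fun x => Real.exp (-((signSum p x ^ 2 + signSum q x ^ 2) - 1) / 5)) := by
  set r := ∑ j, (p j ^ 2 + q j ^ 2) with hrd
  have hr0 : 0 ≤ r := by positivity
  have h4 : ∑ j, (p j ^ 2 + q j ^ 2) ^ 2 ≤ σ := by
    calc ∑ j, (p j ^ 2 + q j ^ 2) ^ 2 ≤ ∑ j, σ * (p j ^ 2 + q j ^ 2) := by
          refine sum_le_sum fun j _ => ?_
          rw [sq]
          exact mul_le_mul_of_nonneg_right (hσ j) (by positivity)
      _ = σ * r := by rw [← mul_sum]
      _ ≤ σ := mul_le_of_le_one_right hσ0 hr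
  have hm2 : 2 * r ^ 2 - 2 * σ ≤ mean (fun x => (signSum p x ^ 2 + signSum q x ^ 2) ^ 2) := by
    rw [mean_sq_add_sq_sq]
    nlinarith [sq_nonneg (∑ j, p j * p j - ∑ j, q j * q j), sq_nonneg (∑ j, p j * q j)]
  have hm3 := mean_sq_add_sq_cube_le p q
  have hm1 := mean_sq_add_sq p q
  rw [← hrd] at hm1 hm3
  -- The cubic Taylor polynomial at `-(t - 1)/5`, expanded in powers of `t`. The quadratic
  -- coefficient `0.024`, times the fourth-moment deficit `2σ`, gives `0.048 σ`.
  have key : ∀ x, (1 / 50 + 3 / 750) * (signSum p x ^ 2 + signSum q x ^ 2) ^ 2 +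
      (-(1 / 5 + 2 / 50 + 3 / 750) * (signSum p x ^ 2 + signSum q x ^ 2) +
      (-(1 / 750) * (signSum p x ^ 2 + signSum q x ^ 2) ^ 3 + (1 + 1 / 5 + 1 / 50 + 1 / 750))) ≤
      Real.exp (-((signSum p x ^ 2 + signSum q x ^ 2) - 1) / 5) := by
    intro x
    refine le_trans (le_of_eq ?_) (cubic_le_exp _)
    ring
  refine le_trans ?_ (mean_mono key)
  rw [mean_add, mean_add, mean_add, mean_const_mul, mean_const_mul, mean_const_mul, mean_const, hm1]
  have hb : 1.005 ≤ 1 + (1 - r) / 5 + (2 * r ^ 2 - 2 * r + 1) / 50 -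
      (15 * r ^ 3 - 6 * r ^ 2 + 3 * r - 1) / 750 := by
    clear_value r
    obtain ⟨e, rfl⟩ : ∃ e, r = 1 - e := ⟨1 - r, by ring⟩
    have he0 : 0 ≤ e := by linarith
    have he1 : e ≤ 1 := by linarith
    have h1 : e ^ 2 ≤ e := by nlinarith
    have h2 : 0 ≤ e ^ 3 := by positivity
    norm_num
    linarith
  norm_num at hb ⊢
  linarith

theorem mul_exp_neg_le (u : ℝ) : u * Real.exp (-u) ≤ 1 / 2 := by
  rw [Real.exp_neg, ← div_eq_mul_inv, div_le_iff₀ (Real.exp_pos u)]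
  rcases le_total 0 u with hu | hu
  · nlinarith [Real.quadratic_le_exp_of_nonneg hu, sq_nonneg (u - 1)]
  · nlinarith [Real.exp_pos u]

/-- Second order Taylor bound for a Gaussian function on a line. -/
theorem exp_neg_quadratic_le {p q r : ℝ} (hr : 0 ≤ r) (h : q ^ 2 ≤ p * r) :
    Real.exp (-(p + 2 * q + r)) ≤ Real.exp (-p) * (1 - 2 * q) + r := by
  set E : ℝ → ℝ := fun s => Real.exp (-(p + 2 * q * s + r * s ^ 2)) with hE
  have hEd : ∀ s, HasDerivAt E (E s * -(2 * q + 2 * r * s)) s := by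
    intro s
    refine HasDerivAt.exp ?_
    have h1 := ((((hasDerivAt_id s).const_mul (2 * q)).const_add p).add
      ((hasDerivAt_pow 2 s).const_mul r)).neg
    refine h1.congr_deriv ?_
    norm_num
    ring
  set k' : ℝ → ℝ := fun s => -(2 * q) * Real.exp (-p) + 2 * r * s - E s * -(2 * q + 2 * r * s)
    with hk'
  have hkd : ∀ s, HasDerivAt (fun s => Real.exp (-p) * (1 - 2 * q * s) + r * s ^ 2 - E s)
      (k' s) s := by
    intro s
    have h1 := ((((hasDerivAt_id s).const_mul (2 * q)).const_sub 1).const_mul (Real.exp (-p))).add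
      ((hasDerivAt_pow 2 s).const_mul r)
    refine (h1.sub (hEd s)).congr_deriv ?_
    simp only [hk']
    norm_num
    ring
  have hkd' : ∀ s, HasDerivAt k' (2 * r - (E s * -(2 * q + 2 * r * s) * -(2 * q + 2 * r * s) +
      E s * -(2 * r))) s := by
    intro s
    have hlin : HasDerivAt (fun s : ℝ => -(2 * q + 2 * r * s)) (-(2 * r)) s := by
      have h1 := (((hasDerivAt_id s).const_mul (2 * r)).const_add (2 * q)).neg
      refine h1.congr_deriv ?_
      ring
    have h2 := (((hasDerivAt_id s).const_mul (2 * r)).const_add (-(2 * q) * Real.exp (-p)))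
    refine (h2.sub ((hEd s).mul hlin)).congr_deriv ?_
    ring
  -- This is `E'' ≤ 2r`: the hypothesis gives `(q + rs)² ≤ rP`, and `P exp (-P) ≤ 1/2`.
  have hmono : Monotone k' := by
    refine monotone_of_deriv_nonneg (fun s => (hkd' s).differentiableAt) fun s => ?_
    rw [(hkd' s).deriv]
    set P := p + 2 * q * s + r * s ^ 2 with hP
    have hPE : E s = Real.exp (-P) := rfl
    have h1 : (q + r * s) ^ 2 ≤ r * P := by rw [hP]; nlinarith
    have h2 := mul_exp_neg_le P
    rw [← hPE] at h2
    have hE0 : 0 ≤ E s := (Real.exp_pos _).le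
    have h3 := mul_le_mul_of_nonneg_right h1 hE0
    have h4 := mul_le_mul_of_nonneg_left h2 hr
    have h5 := mul_nonneg hr hE0
    nlinarith
  have hk0 : k' 0 = 0 := by simp [hk', hE]; ring
  have hmono2 : MonotoneOn (fun s => Real.exp (-p) * (1 - 2 * q * s) + r * s ^ 2 - E s)
      (Set.Ici 0) := by
    refine monotoneOn_of_deriv_nonneg (convex_Ici 0)
      (fun s _ => (hkd s).continuousAt.continuousWithinAt)
      (fun s _ => (hkd s).differentiableAt.differentiableWithinAt) fun s hs => ?_
    rw [(hkd s).deriv, ← hk0]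
    exact hmono (interior_subset hs : s ∈ Set.Ici (0 : ℝ))
  have h01 := hmono2 (Set.mem_Ici.2 le_rfl) (Set.mem_Ici.2 zero_le_one) zero_le_one
  simp only [hE] at h01
  norm_num at h01
  have h2 : -r + (-(2 * q) + -p) = -(p + 2 * q + r) := by ring
  rw [h2] at h01
  linarith

theorem abs_exp_neg_quadratic_sub_le {p q r : ℝ} (hp : 0 ≤ p) (hr : 0 ≤ r) (h : q ^ 2 ≤ p * r) :
    |Real.exp (-(p + 2 * q + r)) - Real.exp (-p) + 2 * q * Real.exp (-p)| ≤ r := by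
  have h1 := exp_neg_quadratic_le hr h
  have h2 : Real.exp (-(p + 2 * q + r)) = Real.exp (-p) * Real.exp (-(2 * q + r)) := by
    rw [← Real.exp_add]
    ring_nf
  have h3 := mul_le_mul_of_nonneg_left (Real.add_one_le_exp (-(2 * q + r))) (Real.exp_pos (-p)).le
  rw [← h2] at h3
  have h4 : r * Real.exp (-p) ≤ r :=
    mul_le_of_le_one_right hr (Real.exp_le_one_iff.2 (neg_nonpos.2 hp))
  rw [abs_le]
  constructor <;> linarith

/-- A sharpening of `t ≤ exp (t - 1)` away from `t = 1`. -/
theorem le_exp_sub_one_sub {t : ℝ} (ht : 0 ≤ t) :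
    t ≤ Real.exp ((t - 1) * (1 - 1 / 2500) + (1 - Real.exp (-(t - 1) / 5)) / 500) := by
  obtain ⟨u, rfl⟩ : ∃ u, t = 1 + u := ⟨t - 1, by ring⟩
  rw [add_sub_cancel_left]
  rcases le_total u 1 with hu | hu
  · have h1 := Real.abs_exp_sub_one_sub_id_le (x := -u / 5) (by rw [abs_le]; constructor <;> linarith)
    have h2 := (abs_le.1 h1).2
    -- The weights are matched, `1/2500 = (1/5)(1/500)`, so the linear corrections cancel and only
    -- the error `u²/12500` remains, which the quadratic term of `exp` absorbs.
    set v := u * (1 - u / 12500) with hv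
    have h3 : v ≤ u * (1 - 1 / 2500) + (1 - Real.exp (-u / 5)) / 500 := by
      rw [hv]
      nlinarith
    refine le_trans ?_ (Real.exp_le_exp.2 h3)
    refine le_trans ?_ (cubic_le_exp v)
    have h4 : -1.001 ≤ v := by
      rw [hv]
      norm_num
      nlinarith
    have h5 : (0.99 : ℝ) ≤ (1 - u / 12500) ^ 2 := by
      norm_num
      nlinarith
    have h6 : 0.99 * u ^ 2 ≤ v ^ 2 := by
      rw [hv, mul_pow]
      nlinarith [sq_nonneg u]
    have h7 : v ^ 2 * 0.3 ≤ v ^ 2 / 2 + v ^ 3 / 6 := by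
      norm_num at h4 ⊢
      nlinarith [mul_nonneg (sq_nonneg v) (by linarith : 0 ≤ v + 1001 / 1000)]
    have h8 : v = u - u ^ 2 / 12500 := by rw [hv]; ring
    norm_num at h6 h7 ⊢
    nlinarith [sq_nonneg u]
  · have h1 : Real.exp (-u / 5) ≤ 1 := Real.exp_le_one_iff.2 (by linarith)
    set v := u * (1 - 1 / 2500) with hv
    refine le_trans ?_ (Real.exp_le_exp.2 (show v ≤ _ by linarith))
    have h2 : 0 ≤ v := by rw [hv]; norm_num; linarith
    refine le_trans ?_ (Real.quadratic_le_exp_of_nonneg h2)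
    rw [hv]
    norm_num
    nlinarith

end SignCube

/-! ### Glynn's formula and permanents of contractions. -/

namespace SignCube

open Finset Matrix

/-- The complex vector of signs given by a point of the cube. -/
def toComplex {n : ℕ} (x : Cube n) : Fin n → ℂ := fun j => ((x j : ℤ) : ℂ)

theorem toComplex_flip {n : ℕ} (x : Cube n) (j : Fin n) :
    toComplex (flip x j) = toComplex x - Pi.single j (2 * toComplex x j) := by
  funext i
  by_cases h : i = j
  · subst h
    simp [toComplex, flip]
    ring
  · simp [toComplex, flip, h]

theorem toComplex_mul_self {n : ℕ} (x : Cube n) (j : Fin n) :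
    toComplex x j * toComplex x j = 1 := by
  have h := Int.units_coe_mul_self (x j)
  simp only [toComplex]
  exact_mod_cast h

theorem norm_toComplex {n : ℕ} (x : Cube n) (j : Fin n) : ‖toComplex x j‖ = 1 := by
  have h := congrArg norm (toComplex_mul_self x j)
  rw [norm_mul, norm_one] at h
  nlinarith [norm_nonneg (toComplex x j)]

/-- Flipping a coordinate missed by `f` changes the sign of the first product only, so the sum
equals its own negative. -/
theorem sum_prod_toComplex_of_not_surjective {n : ℕ} {f : Fin n → Fin n}
    (hf : ¬ Function.Surjective f) :
    ∑ x : Cube n, (∏ j, toComplex x j) * ∏ i, toComplex x (f i) = 0 := by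
  obtain ⟨j, hj⟩ := not_forall.1 hf
  have hflip : ∀ x : Cube n, (∏ i, toComplex (flip x j) i) * ∏ i, toComplex (flip x j) (f i) =
      -((∏ i, toComplex x i) * ∏ i, toComplex x (f i)) := by
    intro x
    have h1 : ∀ i, toComplex (flip x j) (f i) = toComplex x (f i) := by
      intro i
      have : f i ≠ j := fun h => hj ⟨i, h⟩
      simp [toComplex, flip, this]
    have h2 : ∏ i, toComplex (flip x j) i = -∏ i, toComplex x i := by
      rw [← mul_prod_erase univ _ (mem_univ j), ← mul_prod_erase univ _ (mem_univ j)]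
      have h3 : ∏ i ∈ univ.erase j, toComplex (flip x j) i =
          ∏ i ∈ univ.erase j, toComplex x i :=
        prod_congr rfl fun i hi => by simp [toComplex, flip, ne_of_mem_erase hi]
      rw [h3]
      simp [toComplex, flip]
    simp only [h1, h2, neg_mul]
  have h := sum_flip j fun x : Cube n => (∏ j, toComplex x j) * ∏ i, toComplex x (f i)
  simp only [hflip, sum_neg_distrib] at h
  exact self_eq_neg.1 h.symm

/-- Glynn's formula for the permanent. -/
theorem two_pow_mul_permanent {n : ℕ} (A : Matrix (Fin n) (Fin n) ℂ) :
    2 ^ n * A.permanent =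
      ∑ x : Cube n, (∏ j, toComplex x j) * ∏ i, (A *ᵥ toComplex x) i := by
  have h1 : ∀ x : Cube n, (∏ j, toComplex x j) * ∏ i, (A *ᵥ toComplex x) i =
      ∑ f : Fin n → Fin n, (∏ i, A i (f i)) *
        ((∏ j, toComplex x j) * ∏ i, toComplex x (f i)) := by
    intro x
    simp only [mulVec, dotProduct, prod_univ_sum, Fintype.piFinset_univ, mul_sum,
      prod_mul_distrib]
    exact sum_congr rfl fun f _ => by ring
  simp only [h1]
  rw [sum_comm]
  simp only [← mul_sum]
  rw [← permanent_transpose, permanent, mul_sum]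
  symm
  calc _ = ∑ f : Fin n → Fin n with Function.Bijective f, (∏ i, A i (f i)) *
        ∑ x : Cube n, (∏ j, toComplex x j) * ∏ i, toComplex x (f i) := by
        refine (sum_subset (filter_subset _ _) fun f _ hf => ?_).symm
        rw [sum_prod_toComplex_of_not_surjective, mul_zero]
        rw [Finite.surjective_iff_bijective]
        simpa using hf
    _ = ∑ σ : Equiv.Perm (Fin n), (∏ i, A i (σ i)) *
        ∑ x : Cube n, (∏ j, toComplex x j) * ∏ i, toComplex x (σ i) :=
      sum_bij (fun p h => Equiv.ofBijective p (mem_filter.1 h).2) (fun _ _ => mem_univ _)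
        (fun _ _ _ _ h => by injection h)
        (fun b _ => ⟨b, mem_filter.2 ⟨mem_univ _, b.bijective⟩, Equiv.coe_fn_injective rfl⟩)
        fun _ _ => rfl
    _ = _ := by
      refine sum_congr rfl fun σ _ => ?_
      have h2 : ∀ x : Cube n, (∏ j, toComplex x j) * ∏ i, toComplex x (σ i) = 1 := by
        intro x
        rw [Equiv.prod_comp σ (toComplex x), ← prod_mul_distrib]
        simp [toComplex_mul_self]
      simp only [h2, transpose_apply]
      simp [mul_comm]

theorem norm_permanent_le_mean {n : ℕ} (A : Matrix (Fin n) (Fin n) ℂ) :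
    ‖A.permanent‖ ≤ mean fun x => ∏ i, ‖(A *ᵥ toComplex x) i‖ := by
  rw [mean, le_div_iff₀ (by positivity), mul_comm]
  have h := congrArg norm (two_pow_mul_permanent A)
  rw [norm_mul, norm_pow, Complex.norm_ofNat] at h
  rw [h]
  refine (norm_sum_le _ _).trans (le_of_eq (sum_congr rfl fun x _ => ?_))
  rw [norm_mul, norm_prod, norm_prod]
  simp [norm_toComplex]

/-- The matrix `A` does not increase the Euclidean norm of a vector. -/
def IsContraction {n : ℕ} (A : Matrix (Fin n) (Fin n) ℂ) : Prop :=
  ∀ v : Fin n → ℂ, ∑ i, Complex.normSq ((A *ᵥ v) i) ≤ ∑ j, Complex.normSq (v j)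

theorem IsContraction.sum_col_le_one {n : ℕ} {A : Matrix (Fin n) (Fin n) ℂ}
    (hA : IsContraction A) (j : Fin n) : ∑ i, Complex.normSq (A i j) ≤ 1 := by
  have h := hA (Pi.single j 1)
  have h2 : ∑ i, Complex.normSq ((Pi.single j 1 : Fin n → ℂ) i) = 1 := by
    rw [sum_eq_single j] <;> simp +contextual
  rw [h2] at h
  simpa using h

theorem sum_normSq_toComplex {n : ℕ} (x : Cube n) :
    ∑ j, Complex.normSq (toComplex x j) = n := by
  simp [Complex.normSq_eq_norm_sq, norm_toComplex]

/-- The sum over the rows of `A` of a Gaussian function of the signed row sums. -/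
noncomputable def gaussianSum {n : ℕ} (A : Matrix (Fin n) (Fin n) ℂ) (x : Cube n) : ℝ :=
  ∑ i, Real.exp (-(Complex.normSq ((A *ᵥ toComplex x) i) / 5))

theorem gaussianSum_flip_sub_sq_le {n : ℕ} {A : Matrix (Fin n) (Fin n) ℂ}
    (hA : IsContraction A) (x : Cube n) (j : Fin n) :
    (gaussianSum A (flip x j) - gaussianSum A x) ^ 2 ≤
      32 / 25 * Complex.normSq ((Aᵀ *ᵥ fun i =>
        (Real.exp (-(Complex.normSq ((A *ᵥ toComplex x) i) / 5)) : ℂ) *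
          star ((A *ᵥ toComplex x) i)) j) + 32 / 25 := by
  set y := A *ᵥ toComplex x with hy
  set e : Fin n → ℝ := fun i => Real.exp (-(Complex.normSq (y i) / 5)) with he
  set w : Fin n → ℂ := fun i => -(2 * toComplex x j * A i j) with hw
  have hyf : ∀ i, (A *ᵥ toComplex (flip x j)) i = y i + w i := by
    intro i
    rw [toComplex_flip, mulVec_sub, mulVec_single, Pi.sub_apply]
    simp [hw, hy, sub_eq_add_neg, mul_comm]
  have hwn : ∀ i, Complex.normSq (w i) = 4 * Complex.normSq (A i j) := by
    intro i
    simp only [hw, Complex.normSq_neg, Complex.normSq_mul]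
    rw [Complex.normSq_eq_norm_sq (toComplex x j), norm_toComplex]
    norm_num [Complex.normSq_ofNat]
  set q : Fin n → ℝ := fun i => (star (y i) * w i).re / 5 with hq
  have herr : ∀ i, |Real.exp (-(Complex.normSq (y i + w i) / 5)) - e i + 2 * q i * e i| ≤
      4 / 5 * Complex.normSq (A i j) := by
    intro i
    have h1 : q i ^ 2 ≤ Complex.normSq (y i) / 5 * (Complex.normSq (w i) / 5) := by
      have h2 := Complex.abs_re_le_norm (star (y i) * w i)
      have h3 := sq_le_sq' (abs_le.1 h2).1 (abs_le.1 h2).2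
      rw [← Complex.normSq_eq_norm_sq, Complex.normSq_mul, Complex.star_def,
        Complex.normSq_conj] at h3
      simp only [hq, div_pow, Complex.star_def]
      linarith
    have h4 := abs_exp_neg_quadratic_sub_le (div_nonneg (Complex.normSq_nonneg (y i)) (by norm_num))
      (div_nonneg (Complex.normSq_nonneg (w i)) (by norm_num)) h1
    have h5 : Complex.normSq (y i) / 5 + 2 * q i + Complex.normSq (w i) / 5 =
        Complex.normSq (y i + w i) / 5 := by
      simp only [hq, Complex.normSq_apply, Complex.star_def, Complex.mul_re, Complex.conj_re,
        Complex.conj_im, Complex.add_re, Complex.add_im]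
      ring
    rw [h5] at h4
    refine h4.trans_eq ?_
    rw [hwn]
    ring
  -- Flipping `x_j` moves `y` by `-2 x_j` times column `j`. The second-order errors total at most
  -- 4/5 because columns have norm at most 1; the linear part is a coordinate of `Aᵀ` applied to a
  -- vector, so contractivity of `Aᵀ` can bound the sum over `j`.
  have hsum : |gaussianSum A (flip x j) - gaussianSum A x + ∑ i, 2 * q i * e i| ≤ 4 / 5 := by
    have h1 : gaussianSum A (flip x j) - gaussianSum A x + ∑ i, 2 * q i * e i =
        ∑ i, (Real.exp (-(Complex.normSq (y i + w i) / 5)) - e i + 2 * q i * e i) := by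
      simp only [gaussianSum, hyf, sum_add_distrib, sum_sub_distrib]
      rfl
    rw [h1]
    refine (abs_sum_le_sum_abs _ _).trans ((sum_le_sum fun i _ => herr i).trans ?_)
    rw [← mul_sum]
    have := hA.sum_col_le_one j
    linarith
  set G := (Aᵀ *ᵥ fun i => (e i : ℂ) * star (y i)) j with hG
  have hlin : ∑ i, 2 * q i * e i = -(4 / 5) * (toComplex x j * G).re := by
    rw [hG, mulVec, dotProduct, mul_sum, Complex.re_sum, mul_sum]
    refine sum_congr rfl fun i _ => ?_
    have h1 : toComplex x j * (Aᵀ j i * ((e i : ℂ) * star (y i))) =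
        (e i : ℂ) * (toComplex x j * A i j * star (y i)) := by
      rw [transpose_apply]
      ring
    have h2 : star (y i) * w i = ((-2 : ℝ) : ℂ) * (toComplex x j * A i j * star (y i)) := by
      simp only [hw]
      push_cast
      ring
    rw [h1, Complex.re_ofReal_mul]
    simp only [hq]
    rw [h2, Complex.re_ofReal_mul]
    ring
  have hlin2 : (toComplex x j * G).re ^ 2 ≤ Complex.normSq G := by
    have h2 := Complex.abs_re_le_norm (toComplex x j * G)
    have h3 := sq_le_sq' (abs_le.1 h2).1 (abs_le.1 h2).2
    rwa [norm_mul, norm_toComplex, one_mul, ← Complex.normSq_eq_norm_sq] at h3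
  set D := gaussianSum A (flip x j) - gaussianSum A x
  rw [hlin] at hsum
  have h6 := sq_le_sq' (abs_le.1 hsum).1 (abs_le.1 hsum).2
  set R := (toComplex x j * G).re
  nlinarith [sq_nonneg (D - 2 * (4 / 5) * R)]

theorem sum_gaussianSum_flip_sub_sq_le {n : ℕ} {A : Matrix (Fin n) (Fin n) ℂ}
    (hA : IsContraction A) (hAt : IsContraction Aᵀ) (x : Cube n) :
    ∑ j, (gaussianSum A (flip x j) - gaussianSum A x) ^ 2 ≤ 2.88 * n := by
  refine (sum_le_sum fun j _ => gaussianSum_flip_sub_sq_le hA x j).trans ?_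
  rw [sum_add_distrib, ← mul_sum]
  have h := hAt fun i => (Real.exp (-(Complex.normSq ((A *ᵥ toComplex x) i) / 5)) : ℂ) *
    star ((A *ᵥ toComplex x) i)
  -- Each term is `t exp (-2t/5) ≤ 5/4`, and `2.88 = (32/25)(5/4 + 1)`.
  have h2 : ∑ i, Complex.normSq ((Real.exp (-(Complex.normSq ((A *ᵥ toComplex x) i) / 5)) : ℂ) *
      star ((A *ᵥ toComplex x) i)) ≤ ∑ _i : Fin n, (5 / 4 : ℝ) := by
    refine sum_le_sum fun i _ => ?_
    set t := Complex.normSq ((A *ᵥ toComplex x) i)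
    rw [Complex.normSq_mul, Complex.normSq_ofReal, Complex.star_def, Complex.normSq_conj,
      ← Real.exp_add]
    have h3 := mul_exp_neg_le (2 * t / 5)
    rw [show -(t / 5) + -(t / 5) = -(2 * t / 5) by ring]
    change _ * t ≤ _
    linarith
  simp only [sum_const, card_univ, Fintype.card_fin, nsmul_eq_mul] at h2 ⊢
  rw [show (2.88 : ℝ) = 72 / 25 by norm_num]
  linarith

theorem prod_norm_le {n : ℕ} {A : Matrix (Fin n) (Fin n) ℂ} (hA : IsContraction A) (x : Cube n) :
    ∏ i, ‖(A *ᵥ toComplex x) i‖ ≤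
      Real.exp (n / 1000) * Real.exp (-(Real.exp (1 / 5) / 1000) * gaussianSum A x) := by
  rw [← Real.exp_add, ← pow_le_pow_iff_left₀ (by positivity) (Real.exp_pos _).le two_ne_zero,
    ← prod_pow, ← Real.exp_nat_mul]
  simp only [← Complex.normSq_eq_norm_sq]
  refine (prod_le_prod (fun i _ => Complex.normSq_nonneg _) fun i _ =>
    le_exp_sub_one_sub (Complex.normSq_nonneg _)).trans ?_
  rw [← Real.exp_sum]
  refine Real.exp_le_exp.2 ?_
  -- Contractivity makes the linear part `∑ (|y_i|² - 1)` nonpositive, so only the Gaussian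
  -- correction survives.
  have h1 := hA (toComplex x)
  rw [sum_normSq_toComplex] at h1
  have h2 : ∀ t : ℝ, Real.exp (-(t - 1) / 5) = Real.exp (1 / 5) * Real.exp (-(t / 5)) := by
    intro t
    rw [← Real.exp_add]
    ring_nf
  simp only [h2, sum_add_distrib, ← sum_mul, ← sum_div, sum_sub_distrib, ← mul_sum]
  simp only [sum_const, card_univ, Fintype.card_fin, nsmul_eq_mul]
  change _ + ((n : ℝ) * 1 - Real.exp (1 / 5) * gaussianSum A x) / 500 ≤ _
  push_cast
  linarith

theorem normSq_mulVec_toComplex {n : ℕ} (A : Matrix (Fin n) (Fin n) ℂ) (x : Cube n) (i : Fin n) :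
    Complex.normSq ((A *ᵥ toComplex x) i) =
      signSum (fun j => (A i j).re) x ^ 2 + signSum (fun j => (A i j).im) x ^ 2 := by
  simp [Complex.normSq_apply, mulVec, dotProduct, toComplex, signSum, Complex.re_sum,
    Complex.im_sum, sq]

theorem le_mean_gaussianSum {n : ℕ} {A : Matrix (Fin n) (Fin n) ℂ} (hAt : IsContraction Aᵀ)
    {S : Fin n → ℝ} (hS : ∀ i j, ‖A i j‖ ≤ S i) (hS1 : ∀ i, S i ≤ 1) :
    1.005 * n - 0.048 * ∑ i, S i ≤ Real.exp (1 / 5) * mean (gaussianSum A) := by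
  have h1 : mean (gaussianSum A) =
      ∑ i, mean (fun x => Real.exp (-(Complex.normSq ((A *ᵥ toComplex x) i) / 5))) :=
    mean_sum _ _
  have h2 : ∑ i : Fin n, ((1.005 : ℝ) - 0.048 * S i) = 1.005 * n - 0.048 * ∑ i, S i := by
    rw [sum_sub_distrib, mul_sum]
    simp [mul_comm]
  rw [h1, ← h2, mul_sum]
  refine sum_le_sum fun i _ => ?_
  have hS0 : 0 ≤ S i := (norm_nonneg _).trans (hS i i)
  have hn : ∀ j, (A i j).re ^ 2 + (A i j).im ^ 2 = Complex.normSq (A i j) := fun j => by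
    rw [Complex.normSq_apply]
    ring
  have h3 := le_mean_exp (fun j => (A i j).re) (fun j => (A i j).im) (σ := S i)
    (fun j => by
      have h := hS i j
      have h0 := norm_nonneg (A i j)
      rw [hn, Complex.normSq_eq_norm_sq]
      nlinarith [hS1 i]) hS0
    (by
      simp only [hn]
      exact hAt.sum_col_le_one i)
  rw [← mean_const_mul]
  refine h3.trans_eq ?_
  congr 1
  funext x
  rw [normSq_mulVec_toComplex, ← Real.exp_add]
  ring_nf

/-- The permanent of a contraction whose rows have small supremum norms on average is exponentially
small. -/
theorem norm_permanent_le {n : ℕ} {A : Matrix (Fin n) (Fin n) ℂ} (hA : IsContraction A)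
    (hAt : IsContraction Aᵀ) {S : Fin n → ℝ} (hS : ∀ i j, ‖A i j‖ ≤ S i) (hS1 : ∀ i, S i ≤ 1)
    (hsum : ∑ i, S i ≤ n / 100) :
    ‖A.permanent‖ ≤ Real.exp (-(0.000001 * n)) := by
  refine (norm_permanent_le_mean A).trans ((mean_mono fun x => prod_norm_le hA x).trans ?_)
  rw [mean_const_mul]
  have h1 := mean_exp_le (gaussianSum A) (sum_gaussianSum_flip_sub_sq_le hA hAt)
    (show 0 < Real.exp (1 / 5) / 1000 by positivity)
  refine (mul_le_mul_of_nonneg_left h1 (Real.exp_pos _).le).trans ?_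
  rw [← Real.exp_add]
  refine Real.exp_le_exp.2 ?_
  -- The exponent per unit of `n` is at most `(1 - 1.005 + 0.00048)/10³ + 1.44 · 1.23²/10⁶ < -10⁻⁶`.
  have h2 := le_mean_gaussianSum hAt hS hS1
  have h3 : Real.exp (1 / 5) ≤ 1.23 := by
    have h := Real.exp_bound' (x := 1 / 5) (by norm_num) (by norm_num) (n := 3) (by norm_num)
    norm_num [sum_range_succ, Nat.factorial] at h ⊢
    linarith
  have h4 : Real.exp (1 / 5) ^ 2 ≤ 1.23 ^ 2 := pow_le_pow_left₀ (Real.exp_pos _).le h3 2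
  have hn : (0 : ℝ) ≤ n := Nat.cast_nonneg n
  have h5 := mul_le_mul_of_nonneg_left h4 hn
  rw [div_pow]
  norm_num at h2 h5 ⊢
  linarith

/-- A square submatrix of a unitary matrix is a contraction. -/
theorem isContraction_submatrix {m n : ℕ} {U : Matrix (Fin m) (Fin m) ℂ}
    (hU : U ∈ Matrix.unitaryGroup (Fin m) ℂ) (rows cols : Fin n ↪ Fin m) :
    IsContraction (U.submatrix rows cols) := by
  intro v
  set w : Fin m → ℂ := Function.extend cols v 0 with hw
  -- Extending `v` by zero off the chosen columns turns the submatrix into the full unitary;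
  -- omitting rows can only decrease the norm.
  have hsum : ∀ g : Fin m → ℂ → ℂ, (∀ j, g j 0 = 0) → ∑ j, g j (w j) = ∑ j, g (cols j) (v j) := by
    intro g hg
    rw [← sum_subset (subset_univ (univ.map cols)), sum_map]
    · exact sum_congr rfl fun j _ => by rw [hw, cols.injective.extend_apply]
    · intro j _ hj
      rw [hw, Function.extend_apply', Pi.zero_apply, hg]
      rintro ⟨i, rfl⟩
      exact hj (mem_map_of_mem _ (mem_univ i))
  have h1 : ∀ i, (U.submatrix rows cols *ᵥ v) i = (U *ᵥ w) (rows i) := by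
    intro i
    exact (hsum (fun j z => U (rows i) j * z) (by simp)).symm
  have h2 : ∑ j, Complex.normSq (w j) = ∑ j, Complex.normSq (v j) := by
    have := hsum (fun _ z => (Complex.normSq z : ℂ)) (by simp)
    exact_mod_cast this
  have h3 : ∀ u : Fin m → ℂ, star u ⬝ᵥ u = ((∑ j, Complex.normSq (u j) : ℝ) : ℂ) := by
    intro u
    simp [dotProduct, Complex.normSq_eq_conj_mul_self]
  have h4 : ∑ j, Complex.normSq ((U *ᵥ w) j) = ∑ j, Complex.normSq (w j) := by
    have h5 : star (U *ᵥ w) ⬝ᵥ (U *ᵥ w) = star w ⬝ᵥ w := by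
      rw [star_mulVec, dotProduct_mulVec, vecMul_vecMul, ← star_eq_conjTranspose,
        mem_unitaryGroup_iff'.1 hU, vecMul_one]
    rw [h3, h3] at h5
    exact_mod_cast h5
  rw [← h2, ← h4]
  simp only [h1]
  rw [← sum_map univ rows fun i => Complex.normSq ((U *ᵥ w) i)]
  exact sum_le_sum_of_subset_of_nonneg (subset_univ _) fun i _ _ => Complex.normSq_nonneg _

end SignCube

/-! ### The interference term and the uniform probability. -/

namespace LinearOptics

theorem card_lossyOutputs {m n k : ℕ} (hk : k ≤ n) (s : Config m n) :
    (lossyOutputs k s).card = n.choose k := by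
  have h : (Finset.powersetCard (n - k) s.1).card = n.choose k := by
    rw [Finset.card_powersetCard, s.2, Nat.choose_symm hk]
  rw [← h]
  refine Finset.card_bij (fun r _ => r.1) (fun r hr => ?_) (fun r _ r' _ h => Subtype.ext h)
    fun t ht => ?_
  · exact Finset.mem_powersetCard.2 ⟨(Finset.mem_filter.1 hr).2, r.2⟩
  · obtain ⟨h1, h2⟩ := Finset.mem_powersetCard.1 ht
    exact ⟨⟨t, h2⟩, Finset.mem_filter.2 ⟨Finset.mem_univ _, h1⟩, rfl⟩

theorem card_generatedOutputs {m n k : ℕ} (hk : k ≤ n) (hm : n ≤ m) (r : Config m (n - k)) :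
    (generatedOutputs r : Finset (Config m n)).card = (m - n + k).choose k := by
  have h : (r.1ᶜ).card = m - n + k := by
    rw [Finset.card_compl, r.2, Fintype.card_fin]
    omega
  rw [← h, ← Finset.card_powersetCard]
  refine Finset.card_bij (fun s _ => s.1 \ r.1) (fun s hs => ?_) (fun s hs s' hs' h => ?_)
    fun t ht => ?_
  · rw [Finset.mem_powersetCard, Finset.card_sdiff_of_subset (Finset.mem_filter.1 hs).2, s.2, r.2]
    refine ⟨fun x hx => ?_, by omega⟩
    simp only [Finset.mem_sdiff] at hx
    simpa using hx.2
  · refine Subtype.ext ?_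
    rw [← Finset.sdiff_union_of_subset (Finset.mem_filter.1 hs).2,
      ← Finset.sdiff_union_of_subset (Finset.mem_filter.1 hs').2]
    exact congrArg (· ∪ r.1) h
  · obtain ⟨h1, h2⟩ := Finset.mem_powersetCard.1 ht
    have hd : Disjoint t r.1 := by
      rw [Finset.disjoint_left]
      intro x hx
      simpa using h1 hx
    refine ⟨⟨t ∪ r.1, ?_⟩, Finset.mem_filter.2 ⟨Finset.mem_univ _, Finset.subset_union_right⟩, ?_⟩
    · rw [Finset.card_union_of_disjoint hd, h2, r.2]
      omega
    · exact Finset.union_sdiff_cancel_right hd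

theorem outputProb_nonneg {m n : ℕ} (U : Matrix (Fin m) (Fin m) ℂ) (T S : Config m n) :
    0 ≤ outputProb U T S := by
  unfold outputProb
  positivity

theorem outputProb_le_maxProb {m n : ℕ} (U : Matrix (Fin m) (Fin m) ℂ) (T S : Config m n) :
    outputProb U T S ≤ maxProb U T :=
  le_ciSup (Set.finite_range _).bddAbove S

/-- The interference term is an average of output probabilities. -/
theorem interference_mem_Icc {m n k : ℕ} (hk : 1 ≤ k) (hkn : k < n) (hnm : n < m)
    (U : Matrix (Fin m) (Fin m) ℂ) (T s : Config m n) :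
    interference U T k s ∈ Set.Icc 0 (maxProb U T) := by
  have h2 : 1 < (m - n + k).choose k := by
    have h := Nat.choose_le_choose k (show k + 1 ≤ m - n + k by omega)
    rw [Nat.choose_succ_self_right] at h
    omega
  have h2' : (0 : ℝ) < ((m - n + k).choose k : ℝ) - 1 := by
    rw [sub_pos]
    exact_mod_cast h2
  have h3 : (0 : ℝ) < (n.choose k : ℝ) := by exact_mod_cast Nat.choose_pos hkn.le
  have hN := mul_pos h2' h3
  constructor
  · exact div_nonneg (Finset.sum_nonneg fun r _ => Finset.sum_nonneg fun s' _ =>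
      outputProb_nonneg U T s') hN.le
  · rw [interference, div_le_iff₀ hN]
    have h4 : ∀ r ∈ lossyOutputs k s, ∑ s' ∈ (generatedOutputs r).erase s, outputProb U T s' ≤
        (((m - n + k).choose k : ℝ) - 1) * maxProb U T := by
      intro r hr
      refine (Finset.sum_le_card_nsmul _ _ _ fun s' _ => outputProb_le_maxProb U T s').trans_eq ?_
      -- Since `s` itself lies in `G(r)`, erasing it removes exactly one term, matching the `- 1` in
      -- the normalization.
      have hs : s ∈ (generatedOutputs r : Finset (Config m n)) :=
        Finset.mem_filter.2 ⟨Finset.mem_univ _, (Finset.mem_filter.1 hr).2⟩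
      rw [Finset.card_erase_of_mem hs, card_generatedOutputs hkn.le hnm.le, nsmul_eq_mul,
        Nat.cast_sub h2.le, Nat.cast_one]
    refine (Finset.sum_le_card_nsmul _ _ _ h4).trans_eq ?_
    rw [card_lossyOutputs hkn.le, nsmul_eq_mul]
    ring

theorem biasError_le_max {m n k : ℕ} (hk : 1 ≤ k) (hkn : k < n) (hnm : n < m)
    (U : Matrix (Fin m) (Fin m) ℂ) (T s : Config m n) :
    biasError U T k s ≤ max (maxProb U T) (unifProb m n) := by
  obtain ⟨h1, h2⟩ := interference_mem_Icc hk hkn hnm U T s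
  have h3 : 0 ≤ unifProb m n := by unfold unifProb; positivity
  rw [biasError, abs_le]
  constructor
  · linarith [le_max_right (maxProb U T) (unifProb m n)]
  · linarith [le_max_left (maxProb U T) (unifProb m n)]

theorem unifProb_le {m n : ℕ} {c : ℝ} (hc : 0 < c) (hnm : n < m) (hm : c * (n : ℝ) ^ 2 ≤ m) :
    unifProb m n ≤ Real.exp (2 / c) * Real.exp (-(0.000002 * (n : ℝ))) := by
  have hn0 : (0 : ℝ) ≤ n := Nat.cast_nonneg n
  have hch : 0 < m.choose n := Nat.choose_pos hnm.le
  rw [unifProb, ← Real.exp_add]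
  -- For `n ≤ 2/c` the factor `exp (2/c)` absorbs everything; otherwise `m ≥ c n² ≥ 2n`, and the
  -- central binomial coefficient is at least `2 ^ n`.
  rcases le_total (n : ℝ) (2 / c) with h | h
  · have h1 : (1 : ℝ) / (m.choose n : ℝ) ≤ 1 := by
      rw [div_le_one (by exact_mod_cast hch)]
      exact_mod_cast hch
    refine h1.trans (Real.one_le_exp ?_)
    norm_num
    linarith
  · rw [div_le_iff₀ hc] at h
    have h2 : 2 * n ≤ m := by
      have : (2 * n : ℝ) ≤ m := by nlinarith
      exact_mod_cast this
    have h3 : ∀ j : ℕ, 2 ^ j ≤ (2 * j).choose j := by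
      intro j
      induction j with
      | zero => simp
      | succ j ih =>
        have h4 := Nat.succ_mul_centralBinom_succ j
        rw [Nat.centralBinom_eq_two_mul_choose, Nat.centralBinom_eq_two_mul_choose] at h4
        have h5 : 2 * (j + 1) * (2 * j).choose j ≤ (j + 1) * (2 * (j + 1)).choose (j + 1) := by
          rw [h4]
          gcongr
          omega
        have h6 : 2 * (2 * j).choose j ≤ (2 * (j + 1)).choose (j + 1) :=
          Nat.le_of_mul_le_mul_left (by linarith) (Nat.succ_pos j)
        rw [pow_succ]
        omega
    have h7 : (2 : ℝ) ^ n ≤ (m.choose n : ℝ) := by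
      exact_mod_cast (h3 n).trans (Nat.choose_le_choose n h2)
    have h8 : Real.exp (0.000002 * (n : ℝ)) ≤ 2 ^ n := by
      rw [mul_comm, Real.exp_nat_mul]
      gcongr
      have := Real.add_one_le_exp (-0.000002 : ℝ)
      rw [Real.exp_neg] at this
      have h9 := mul_le_mul_of_nonneg_left this (Real.exp_pos 0.000002).le
      rw [mul_inv_cancel₀ (Real.exp_pos _).ne'] at h9
      norm_num at h9 ⊢
      linarith
    have h10 : (1 : ℝ) / (m.choose n : ℝ) ≤ Real.exp (-(0.000002 * (n : ℝ))) := by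
      rw [Real.exp_neg, one_div]
      exact inv_anti₀ (Real.exp_pos _) (h8.trans h7)
    refine h10.trans (Real.exp_le_exp.2 ?_)
    have : 0 < 2 / c := by positivity
    linarith

end LinearOptics

/-! ### Norm bounds for contractions and the conclusion. -/

namespace SignCube

theorem IsContraction.opNorm_le_one {n : ℕ} {A : Matrix (Fin n) (Fin n) ℂ}
    (hA : IsContraction A) : LinearOptics.opNorm A ≤ 1 := by
  refine ContinuousLinearMap.opNorm_le_bound _ zero_le_one fun v => ?_
  rw [one_mul, EuclideanSpace.norm_eq, EuclideanSpace.norm_eq, Matrix.ofLp_toEuclideanCLM]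
  simp only [← Complex.normSq_eq_norm_sq]
  exact Real.sqrt_le_sqrt (hA v.ofLp)

theorem IsContraction.norm_apply_le_one {n : ℕ} {A : Matrix (Fin n) (Fin n) ℂ}
    (hA : IsContraction A) (i j : Fin n) : ‖A i j‖ ≤ 1 := by
  have h1 := hA.sum_col_le_one j
  have h2 := Finset.single_le_sum (fun i _ => Complex.normSq_nonneg (A i j)) (Finset.mem_univ i)
  have h3 := h2.trans h1
  rw [Complex.normSq_eq_norm_sq] at h3
  nlinarith [norm_nonneg (A i j)]

end SignCube

theorem mainTheorem9 :
    ∃ δ : ℝ, 0 < δ ∧ ∀ c : ℝ, 0 < c → ∃ C : ℝ, 0 < C ∧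
      ∀ (m n k : ℕ), 1 ≤ k → k < n → n < m → c * (n : ℝ) ^ 2 ≤ (m : ℝ) →
      ∀ U : Matrix (Fin m) (Fin m) ℂ, U ∈ Matrix.unitaryGroup (Fin m) ℂ →
      ∀ (T : LinearOptics.Config m n) (rows cols : Fin n ↪ Fin m)
        (A : Matrix (Fin n) (Fin n) ℂ),
        A = U.submatrix rows cols →
        LinearOptics.maxProb U T = ‖A.permanent‖ ^ 2 →
        LinearOptics.rowSupAverage A ≤ δ * LinearOptics.opNorm A →
        ∀ s : LinearOptics.Config m n,
          LinearOptics.biasError U T k s ≤ C * Real.exp (-(0.000002 * (n : ℝ))) := by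
  refine ⟨1 / 100, by norm_num, fun c hc => ⟨Real.exp (2 / c), Real.exp_pos _, ?_⟩⟩
  intro m n k hk hkn hnm hm U hU T rows cols A hAU hmax hrow s
  have hn : (0 : ℝ) < n := by exact_mod_cast (by omega : 0 < n)
  have hA : SignCube.IsContraction A := hAU ▸ SignCube.isContraction_submatrix hU rows cols
  have hUt : U.transpose ∈ Matrix.unitaryGroup (Fin m) ℂ := by
    rw [Matrix.mem_unitaryGroup_iff', show star U.transpose = (star U).transpose from rfl,
      ← Matrix.transpose_mul, Matrix.mem_unitaryGroup_iff.1 hU, Matrix.transpose_one]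
  have hAt : SignCube.IsContraction A.transpose := by
    rw [hAU, Matrix.transpose_submatrix]
    exact SignCube.isContraction_submatrix hUt cols rows
  have hne : Nonempty (Fin n) := ⟨⟨0, by omega⟩⟩
  -- A submatrix of a unitary has operator norm at most 1, so the hypothesis with `δ = 1/100` bounds
  -- the sum of row sup norms by `n/100`.
  have hsum : ∑ i : Fin n, ⨆ j, ‖A i j‖ ≤ n / 100 := by
    have h := hrow.trans (mul_le_mul_of_nonneg_left hA.opNorm_le_one (by norm_num))
    rw [LinearOptics.rowSupAverage, one_div, inv_mul_le_iff₀ hn] at h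
    linarith
  have hper := SignCube.norm_permanent_le hA hAt
    (fun i j => le_ciSup (Set.finite_range fun j => ‖A i j‖).bddAbove j)
    (fun i => ciSup_le fun j => hA.norm_apply_le_one i j) hsum
  have hp : LinearOptics.maxProb U T ≤ Real.exp (-(0.000002 * (n : ℝ))) := by
    rw [hmax]
    refine (pow_le_pow_left₀ (norm_nonneg _) hper 2).trans_eq ?_
    rw [← Real.exp_nat_mul]
    congr 1
    push_cast
    ring
  refine (LinearOptics.biasError_le_max hk hkn hnm U T s).trans
    (max_le (hp.trans ?_) (LinearOptics.unifProb_le hc hnm hm))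
  exact le_mul_of_one_le_left (Real.exp_pos _).le (Real.one_le_exp (by positivity))
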